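/- Let $n,L\ge 1$ and let $H\in\mathbb R^{L\times L}$ be an orthogonal matrix. Put $N=n(n-1)/2$ and, for $m\ge1$, $M=m(m+1)/2$. Model. Let $\Lambda^*\in[0,1]^{n\times n\times L}$ be the tensor of connection probabilities of a dynamic stochastic block model (DSBM): for some number of classes $m^*$, some assignment $z^*_l:\{1,\dots,n\}\to\{1,\dots,m^*\}$ of the nodes to classes at each time $l=1,\dots,L$, and some $G\in[0,1]^{m^*\times m^*\times L}$ with $G_{k,k',l}=G_{k',k,l}$, one has $\Lambda^*_{i,j,l}=G_{z^*_l(i),z^*_l(j),l}$ for $i\ne j$ and $\Lambda^*_{i,i,l}=0$. One observes a random tensor $B\in\{0,1\}^{n\times n\times L}$ with $B_{i,j,l}=B_{j,i,l}$ and $B_{i,i,l}=0$, where the variables $B_{i,j,l}$, $i<j$, $1\le l\le L$, are independent and $\mathbb P(B_{i,j,l}=1)=\Lambda^*_{i,j,l}$. Let $a,\theta^*\in\mathbb R^{NL}$ be the vectors of the entries of $B$ and $\Lambda^*$, respectively, with indices $(i,j,l)$, $i<j$. Clustering matrices. For $1\le m\le n$ let $\mathcal C(m,n,L)$ be a non-empty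 set of sequences $(Z^{(1)},\dots,Z^{(L)})$ of membership matrices $Z^{(l)}\in\{0,1\}^{n\times m}$ (exactly one $1$ in every row), such that $\log|\mathcal C(m,n,L)|\ge 2\log m$. With such a sequence associate the block diagonal matrix $C\in\{0,1\}^{NL\times ML}$ whose $l$-th block has rows indexed by pairs of nodes $i_1<i_2$ and columns indexed by pairs of classes $k_1\le k_2$, with entry $1$ if at time $l$ one of the nodes $i_1,i_2$ is in class $k_1$ and the other one is in class $k_2$, and entry $0$ otherwise; write $C\in\mathcal C(m,n,L)$. Let $W=H\otimes I_M$. Estimator. For $1\le m\le n$ and $J\subseteq\{1,\dots,ML\}$ put $$\mathrm{Pen}(|J|,m)=11\log|\mathcal C(m,n,L)|+\frac{11}{2}|J|\log\Big(\frac{25\,m^2L}{|J|}\Big),$$ where the second summand is $0$ if $J=\emptyset$. Let $(\hat m,\hat J,\hat d,\hat C)$ be a solution of $$\min_{m,J,d,C}\big[\|a-CW^Td\|^2+\mathrm{Pen}(|J|,m)\big]\quad\text{subject to } d_j=0 \text{ for } j\notin J,$$ over $1\le m\le n$, $J\subseteq\{1,\dots,ML\}$, $d\in\mathbb R^{ML}$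 and $C\in\mathcal C(m,n,L)$. Put $\hat\theta=\hat C\hat W^T\hat d$ with $\hat W=H\otimes I_{\hat m(\hat m+1)/2}$, and let $\hat\Lambda$ be the tensor, symmetric in its first two indices and with zero diagonal, whose entries with $i<j$ are those of $\hat\theta$ (assumed to be a measurable function on the probability space). Then, for every $t>0$, with probability at least $1-9e^{-t}$, $$\frac{\|\hat\Lambda-\Lambda^*\|^2}{n^2L}\le\min_{m,J,d,\;C\in\mathcal C(m,n,L)}\left[\frac{6\,\|CW^Td_{(J)}-\theta^*\|^2}{n^2L}+\frac{4\,\mathrm{Pen}(|J|,m)}{n^2L}\right]+\frac{38\,t}{n^2L},$$ and $$\mathbb E\left(\frac{\|\hat\Lambda-\Lambda^*\|^2}{n^2L}\right)\le\min_{m,J,d,\;C\in\mathcal C(m,n,L)}\left[\frac{6\,\|CW^Td_{(J)}-\theta^*\|^2}{n^2L}+\frac{4\,\mathrm{Pen}(|J|,m)}{n^2L}+\frac{342}{n^2L}\right].$$ Here the minima (which are attained) are over $1\le m\le n$, $J\subseteq\{1,\dots,ML\}$, $d\in\mathbb R^{ML}$ and $C\in\mathcal C(m,n,L)$; $d_{(J)}$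 is $d$ with all entries outside $J$ set to zero; and $\|\cdot\|$ is the Euclidean norm of vectors and the Frobenius norm of tensors. -/

import Mathlib

open scoped Kronecker
open MeasureTheory ProbabilityTheory

noncomputable section

namespace DSBM

/-- Unordered pairs of distinct nodes, indexed as `(i₁, i₂)` with `i₁ < i₂`; there are
`N = n (n - 1) / 2` of them. -/
abbrev NodePair (n : ℕ) : Type := {p : Fin n × Fin n // p.1 < p.2}

/-- Unordered pairs of classes, indexed as `(k₁, k₂)` with `k₁ ≤ k₂`; there are
`M = m (m + 1) / 2` of them. -/
abbrev ClassPair (m : ℕ) : Type := {p : Fin m × Fin m // p.1 ≤ p.2}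

/-- A sequence of `L` clusterings of `n` nodes into `m` (possibly empty) classes. The `l`-th
membership matrix `Z` (binary, exactly one `1` per row) is recorded by its label map:
`Z i k = 1` if and only if `z l i = k`. -/
abbrev Clustering (m n L : ℕ) : Type := Fin L → Fin n → Fin m

/-- The `N × M` clustering matrix of node pairs into class pairs at one time instant. -/
def pairMatrix {m n : ℕ} (z : Fin n → Fin m) : Matrix (NodePair n) (ClassPair m) ℝ :=
  Matrix.of fun i k =>
    if (z i.1.1 = k.1.1 ∧ z i.1.2 = k.1.2) ∨ (z i.1.1 = k.1.2 ∧ z i.1.2 = k.1.1) then 1 else 0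

/-- The `NL × ML` block diagonal matrix `C` with the blocks `pairMatrix (z l)`. -/
def clusterMatrix {m n L : ℕ} (z : Clustering m n L) :
    Matrix (Fin L × NodePair n) (Fin L × ClassPair m) ℝ :=
  Matrix.of fun i k => if i.1 = k.1 then pairMatrix (z i.1) i.2 k.2 else 0

/-- The matrix `W = H ⊗ I_M`. -/
def transformMatrix {L : ℕ} (H : Matrix (Fin L) (Fin L) ℝ) (m : ℕ) :
    Matrix (Fin L × ClassPair m) (Fin L × ClassPair m) ℝ :=
  H ⊗ₖ (1 : Matrix (ClassPair m) (ClassPair m) ℝ)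

/-- The vector `C Wᵀ d`. -/
def fit {m n L : ℕ} (H : Matrix (Fin L) (Fin L) ℝ) (z : Clustering m n L)
    (d : Fin L × ClassPair m → ℝ) : Fin L × NodePair n → ℝ :=
  (clusterMatrix z * (transformMatrix H m).transpose).mulVec d

/-- The vector `d_(J)`: the entries of `d` outside `J` are set to zero. -/
def truncate {ι : Type*} [DecidableEq ι] (J : Finset ι) (d : ι → ℝ) : ι → ℝ :=
  fun j => if j ∈ J then d j else 0

/-- The squared Euclidean norm. -/
def sqNorm {ι : Type*} [Fintype ι] (x : ι → ℝ) : ℝ := ∑ i, x i ^ 2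

/-- The squared Frobenius norm of an `n × n × L` tensor. -/
def tensorSqNorm {n L : ℕ} (A : Fin n → Fin n → Fin L → ℝ) : ℝ :=
  ∑ l, ∑ i, ∑ j, A i j l ^ 2

/-- Vectorization of a tensor, keeping only the entries `(i₁, i₂, l)` with `i₁ < i₂`. -/
def vectorize {n L : ℕ} (A : Fin n → Fin n → Fin L → ℝ) : Fin L × NodePair n → ℝ :=
  fun e => A e.2.1.1 e.2.1.2 e.1

/-- Packing a vector into the symmetric tensor with zero diagonal that it represents. -/
def pack {n L : ℕ} (θ : Fin L × NodePair n → ℝ) : Fin n → Fin n → Fin L → ℝ :=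
  fun i j l =>
    if h : i < j then θ (l, ⟨(i, j), h⟩)
    else if h : j < i then θ (l, ⟨(j, i), h⟩)
    else 0

/-- `Pen(|J|, m)`, with `s = |J|`; the second summand is `0` for `s = 0`. -/
def pen {n L : ℕ} (𝒞 : (m : ℕ) → Finset (Clustering m n L)) (s m : ℕ) : ℝ :=
  11 * Real.log ((𝒞 m).card : ℝ) +
    11 / 2 * (s : ℝ) * Real.log (25 * (m : ℝ) ^ 2 * (L : ℝ) / (s : ℝ))

/-- The unknowns `(m, J, d, C)`. -/
structure Params (n L : ℕ) where
  m : ℕ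
  J : Finset (Fin L × ClassPair m)
  d : Fin L × ClassPair m → ℝ
  z : Clustering m n L

/-- `1 ≤ m ≤ n` and `C ∈ 𝒞(m, n, L)`. -/
def Params.Admissible {n L : ℕ} (p : Params n L)
    (𝒞 : (m : ℕ) → Finset (Clustering m n L)) : Prop :=
  1 ≤ p.m ∧ p.m ≤ n ∧ p.z ∈ 𝒞 p.m

/-- The constraint `d_{Jᶜ} = 0`. -/
def Params.Supported {n L : ℕ} (p : Params n L) : Prop := ∀ j, j ∉ p.J → p.d j = 0

/-- The criterion `‖a - C Wᵀ d‖² + Pen(|J|, m)`. -/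
def objective {n L : ℕ} (H : Matrix (Fin L) (Fin L) ℝ)
    (𝒞 : (m : ℕ) → Finset (Clustering m n L)) (a : Fin L × NodePair n → ℝ)
    (p : Params n L) : ℝ :=
  sqNorm (a - fit H p.z p.d) + pen 𝒞 p.J.card p.m

/-- `p` solves the penalized least squares problem for the data vector `a`. -/
def IsSolution {n L : ℕ} (H : Matrix (Fin L) (Fin L) ℝ)
    (𝒞 : (m : ℕ) → Finset (Clustering m n L)) (a : Fin L × NodePair n → ℝ)
    (p : Params n L) : Prop :=
  (p.Admissible 𝒞 ∧ p.Supported) ∧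
    ∀ p' : Params n L, p'.Admissible 𝒞 → p'.Supported →
      objective H 𝒞 a p ≤ objective H 𝒞 a p'

/-- The estimator of the tensor of connection probabilities: `C Wᵀ d`, packed into a tensor. -/
def estimate {n L : ℕ} (H : Matrix (Fin L) (Fin L) ℝ) (p : Params n L) :
    Fin n → Fin n → Fin L → ℝ :=
  pack (fit H p.z p.d)

/-- `Λ` is the tensor of connection probabilities of a dynamic stochastic block model: for some
number of classes, some memberships at each time and some symmetric connectivity tensor `G` of
probabilities, `Λ i j l = G (z l i) (z l j) l` for distinct nodes, and the diagonal is zero. -/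
def IsBlockTensor {n L : ℕ} (Λ : Fin n → Fin n → Fin L → ℝ) : Prop :=
  ∃ (m : ℕ) (z : Clustering m n L) (G : Fin m → Fin m → Fin L → ℝ),
    (∀ k k' l, G k k' l = G k' k l) ∧
    (∀ k k' l, 0 ≤ G k k' l ∧ G k k' l ≤ 1) ∧
    (∀ i j l, i ≠ j → Λ i j l = G (z l i) (z l j) l) ∧
    (∀ i l, Λ i i l = 0)

/-- `B` is the random adjacency tensor of an undirected dynamic network with connection
probabilities `Λ`: it is binary, symmetric, with zero diagonal, and the entries with `i < j` are
independent Bernoulli variables with `P (B i j l = 1) = Λ i j l`. -/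
structure IsAdjacencyTensor {n L : ℕ} {Ω : Type*} [MeasurableSpace Ω] (μ : Measure Ω)
    (Λ : Fin n → Fin n → Fin L → ℝ) (B : Ω → Fin n → Fin n → Fin L → ℝ) : Prop where
  measurable : ∀ i j l, Measurable fun ω => B ω i j l
  binary : ∀ ω i j l, B ω i j l = 0 ∨ B ω i j l = 1
  symm : ∀ ω i j l, B ω i j l = B ω j i l
  diag : ∀ ω i l, B ω i i l = 0
  prob : ∀ i j l, μ.real {ω | B ω i j l = 1} = Λ i j l
  indep : iIndepFun (fun (e : Fin L × NodePair n) (ω : Ω) => vectorize (B ω) e) μ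

/-- The normalized squared error `‖Λ' - Λ‖² / (n² L)`. -/
def normError {n L : ℕ} (Λ' Λ : Fin n → Fin n → Fin L → ℝ) : ℝ :=
  tensorSqNorm (Λ' - Λ) / ((n : ℝ) ^ 2 * (L : ℝ))

/-- The quantity `6 ‖C Wᵀ d_(J) - θ‖² / (n² L) + 4 Pen(|J|, m) / (n² L)`. -/
def oracleValue {n L : ℕ} (H : Matrix (Fin L) (Fin L) ℝ)
    (𝒞 : (m : ℕ) → Finset (Clustering m n L)) (θ : Fin L × NodePair n → ℝ)
    (p : Params n L) : ℝ :=
  6 * sqNorm (fit H p.z (truncate p.J p.d) - θ) / ((n : ℝ) ^ 2 * (L : ℝ)) +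
    4 * pen 𝒞 p.J.card p.m / ((n : ℝ) ^ 2 * (L : ℝ))

end DSBM

end

/-! Fix an oracle fit `η = C Wᵀ d_(J)` and let `ξ = a - θ*` be the noise. Comparing the criterion at
the estimator with its value at `η`, the cross term only sees the projection `Π ξ` onto a space
containing `θ̂ - η`. Adjoining the deterministic vector `η` to the fits of the selected model gives
such a space, of dimension at most `|J| + 1`. Completing squares leaves `8 ‖Π ξ‖²` to be absorbed by
the penalty.

The selected model is random, so all models are controlled at once. Hoeffding's lemma makes `ξ`
sub-Gaussian with proxy `1/4`, and Gaussian linearization then gives `E exp ‖Π ξ‖² ≤ √2 ^ dim`. Let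
`S` be the sum over all models of `exp (‖Π ξ‖² - weight)`. Counting models yields `E S ≤ 9`, and `‖Π
ξ‖² ≤ weight + log S` holds for every model, hence for the selected one, whose measurability is
never needed.

Since `8 weight ≤ 2 pen`, the vector error is at most `3 ‖η - θ*‖² + 2 pen + 8 log S`, and the
tensor norm doubles this. Markov's inequality for `S` gives the tail bound; `log S ≤ S` gives the
expectation. -/

namespace DSBM

/-! ### Exponential moments of projected Bernoulli noise -/

section Concentration

variable {V : Type*} [NormedAddCommGroup V] [InnerProductSpace ℝ V] [FiniteDimensional ℝ V]
  [MeasurableSpace V] [BorelSpace V]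

theorem integral_exp_neg_quarter_sq_norm_add_inner (w : V) :
    ∫ v : V, Real.exp (-(1 / 4) * ‖v‖ ^ 2 + inner ℝ w v) =
      (4 * Real.pi) ^ (Module.finrank ℝ V / 2 : ℝ) * Real.exp (‖w‖ ^ 2) := by
  have h := GaussianFourier.integral_cexp_neg_mul_sq_norm_add (b := (1 / 4 : ℂ))
    (by norm_num) 1 w
  apply Complex.ofReal_injective
  rw [← integral_complex_ofReal]
  have h4 : ((Real.pi : ℂ) / (1 / 4)) = ((4 * Real.pi : ℝ) : ℂ) := by push_cast; ring
  rw [h4] at h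
  push_cast [Complex.ofReal_cpow (show (0 : ℝ) ≤ 4 * Real.pi by positivity)] at h ⊢
  norm_num at h ⊢
  exact h

theorem lintegral_exp_neg_quarter_sq_norm_add_inner (w : V) :
    ∫⁻ v : V, ENNReal.ofReal (Real.exp (-(1 / 4) * ‖v‖ ^ 2 + inner ℝ w v)) =
      ENNReal.ofReal ((4 * Real.pi) ^ (Module.finrank ℝ V / 2 : ℝ) * Real.exp (‖w‖ ^ 2)) := by
  have h := integral_exp_neg_quarter_sq_norm_add_inner w
  rw [← h, ofReal_integral_eq_lintegral_ofReal]
  -- A non-integrable function has Bochner integral `0`, so the positive value just computed forces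
  -- integrability.
  · apply Integrable.of_integral_ne_zero
    rw [h]; positivity
  · exact Filter.Eventually.of_forall fun _ => (Real.exp_pos _).le

theorem lintegral_exp_neg_eighth_sq_norm :
    ∫⁻ v : V, ENNReal.ofReal (Real.exp (-(1 / 8) * ‖v‖ ^ 2)) =
      ENNReal.ofReal ((8 * Real.pi) ^ (Module.finrank ℝ V / 2 : ℝ)) := by
  have h := GaussianFourier.integral_rexp_neg_mul_sq_norm (V := V) (b := 1 / 8) (by norm_num)
  have h8 : Real.pi / (1 / 8) = 8 * Real.pi := by ring
  rw [h8] at h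
  rw [← h, ofReal_integral_eq_lintegral_ofReal]
  · apply Integrable.of_integral_ne_zero
    rw [h]; positivity
  · exact Filter.Eventually.of_forall fun _ => (Real.exp_pos _).le

/-- The exponential moment of the squared norm of a sub-Gaussian vector with variance
proxy `1 / 4`. -/
theorem lintegral_exp_sq_norm_le {Ω : Type*} [MeasurableSpace Ω] (μ : Measure Ω) [SFinite μ]
    (X : Ω → V) (hX : Measurable X)
    (hsub : ∀ v : V, ∫⁻ ω, ENNReal.ofReal (Real.exp (inner ℝ (X ω) v)) ∂μ ≤
      ENNReal.ofReal (Real.exp (1 / 8 * ‖v‖ ^ 2))) :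
    ∫⁻ ω, ENNReal.ofReal (Real.exp (‖X ω‖ ^ 2)) ∂μ ≤
      ENNReal.ofReal (√2 ^ Module.finrank ℝ V) := by
  set k := Module.finrank ℝ V
  have hc : (0 : ℝ) < (4 * Real.pi) ^ (k / 2 : ℝ) := by positivity
  -- Linearize `exp ‖X‖²` as a Gaussian integral over `v` of exponentials linear in `X`, swap by
  -- Tonelli, and apply `hsub`. The exponent `-1/4 + 1/8` stays negative, and the ratio of Gaussian
  -- constants is `2 ^ (k/2)`.
  have key : ENNReal.ofReal ((4 * Real.pi) ^ (k / 2 : ℝ)) *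
      ∫⁻ ω, ENNReal.ofReal (Real.exp (‖X ω‖ ^ 2)) ∂μ ≤
        ENNReal.ofReal ((8 * Real.pi) ^ (k / 2 : ℝ)) := by
    rw [← lintegral_const_mul' _ _ ENNReal.ofReal_ne_top]
    calc
      _ = ∫⁻ ω, ∫⁻ v : V, ENNReal.ofReal
            (Real.exp (-(1 / 4) * ‖v‖ ^ 2 + inner ℝ (X ω) v)) ∂volume ∂μ := by
          refine lintegral_congr fun ω => ?_
          rw [lintegral_exp_neg_quarter_sq_norm_add_inner, ENNReal.ofReal_mul hc.le]
      _ = ∫⁻ v : V, ∫⁻ ω, ENNReal.ofReal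
            (Real.exp (-(1 / 4) * ‖v‖ ^ 2 + inner ℝ (X ω) v)) ∂μ := by
          rw [lintegral_lintegral_swap]
          apply Measurable.aemeasurable
          have : Measurable fun p : Ω × V => inner ℝ (X p.1) p.2 :=
            (hX.comp measurable_fst).inner measurable_snd
          simp only [Function.uncurry_def]
          fun_prop
      _ ≤ ∫⁻ v : V, ENNReal.ofReal (Real.exp (-(1 / 8) * ‖v‖ ^ 2)) := by
          refine lintegral_mono fun v => ?_
          calc
            _ = ENNReal.ofReal (Real.exp (-(1 / 4) * ‖v‖ ^ 2)) *
                ∫⁻ ω, ENNReal.ofReal (Real.exp (inner ℝ (X ω) v)) ∂μ := by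
              rw [← lintegral_const_mul' _ _ ENNReal.ofReal_ne_top]
              refine lintegral_congr fun ω => ?_
              rw [Real.exp_add, ENNReal.ofReal_mul (Real.exp_pos _).le]
            _ ≤ _ := by
              refine (mul_le_mul_right (hsub v) _).trans_eq ?_
              rw [← ENNReal.ofReal_mul (Real.exp_pos _).le, ← Real.exp_add]
              ring_nf
      _ = _ := lintegral_exp_neg_eighth_sq_norm
  have hsplit : (8 * Real.pi) ^ (k / 2 : ℝ) = (4 * Real.pi) ^ (k / 2 : ℝ) * √2 ^ k := by
    rw [show 8 * Real.pi = 4 * Real.pi * 2 by ring,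
      Real.mul_rpow (by positivity) (by norm_num), Real.sqrt_eq_rpow, ← Real.rpow_natCast,
      ← Real.rpow_mul (by norm_num)]
    ring_nf
  rw [hsplit, ENNReal.ofReal_mul hc.le] at key
  exact (ENNReal.mul_le_mul_iff_right (by simpa using hc) ENNReal.ofReal_ne_top).1 key

/-- For `v` in `U` the projection of `X` has the same inner product with `v` as `X` itself, so it is
sub-Gaussian inside `U` and only the dimension of `U` enters. -/
theorem exp_sq_norm_starProjection_moment {ι Ω : Type*} [Fintype ι] [MeasurableSpace Ω]
    (μ : Measure Ω) [SFinite μ] (X : Ω → EuclideanSpace ℝ ι) (hX : Measurable X)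
    (hsub : ∀ v, ∫⁻ ω, ENNReal.ofReal (Real.exp (inner ℝ (X ω) v)) ∂μ ≤
      ENNReal.ofReal (Real.exp (1 / 8 * ‖v‖ ^ 2)))
    (U : Submodule ℝ (EuclideanSpace ℝ ι)) :
    Integrable (fun ω => Real.exp (‖U.starProjection (X ω)‖ ^ 2)) μ ∧
      ∫ ω, Real.exp (‖U.starProjection (X ω)‖ ^ 2) ∂μ ≤ √2 ^ Module.finrank ℝ U := by
  have hm : Measurable fun ω => U.orthogonalProjectionOnto (X ω) :=
    U.orthogonalProjectionOnto.continuous.measurable.comp hX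
  have h := lintegral_exp_sq_norm_le μ (fun ω => U.orthogonalProjectionOnto (X ω)) hm (by
    intro v
    have := hsub v
    simpa using this)
  have hnorm : ∀ ω, ‖U.starProjection (X ω)‖ = ‖U.orthogonalProjectionOnto (X ω)‖ := fun ω => rfl
  simp only [hnorm]
  have hmeas : AEStronglyMeasurable
      (fun ω => Real.exp (‖U.orthogonalProjectionOnto (X ω)‖ ^ 2)) μ :=
    (by fun_prop : Measurable _).aestronglyMeasurable
  have hpos : 0 ≤ᵐ[μ] fun ω => Real.exp (‖U.orthogonalProjectionOnto (X ω)‖ ^ 2) :=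
    Filter.Eventually.of_forall fun _ => (Real.exp_pos _).le
  refine ⟨⟨hmeas, ?_⟩, ?_⟩
  · rw [hasFiniteIntegral_iff_ofReal hpos]
    exact h.trans_lt ENNReal.ofReal_lt_top
  · rw [integral_eq_lintegral_of_nonneg_ae hpos hmeas]
    exact ENNReal.toReal_le_of_le_ofReal (by positivity) h

/-- Centered independent Bernoulli variables form a sub-Gaussian vector with variance
proxy `1 / 4`. -/
theorem lintegral_exp_inner_centered_le {ι Ω : Type*} [Fintype ι] [MeasurableSpace Ω]
    (μ : Measure Ω) [IsProbabilityMeasure μ] (Y : ι → Ω → ℝ) (θ : ι → ℝ)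
    (hm : ∀ e, Measurable (Y e)) (hY : ∀ e ω, Y e ω = 0 ∨ Y e ω = 1)
    (hθ : ∀ e, μ.real {ω | Y e ω = 1} = θ e) (hind : iIndepFun Y μ)
    (v : EuclideanSpace ℝ ι) :
    ∫⁻ ω, ENNReal.ofReal (Real.exp
      (inner ℝ (WithLp.toLp 2 (fun e => Y e ω - θ e) : EuclideanSpace ℝ ι) v)) ∂μ ≤
      ENNReal.ofReal (Real.exp (1 / 8 * ‖v‖ ^ 2)) := by
  have hmean : ∀ e, μ[Y e] = θ e := by
    intro e
    have hs : MeasurableSet {ω | Y e ω = 1} := hm e (measurableSet_singleton 1)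
    have : Y e = Set.indicator {ω | Y e ω = 1} 1 := by
      funext ω
      rcases hY e ω with h | h <;> simp [Set.indicator, h]
    rw [this, integral_indicator_one hs, hθ]
  -- Hoeffding's lemma on `[0, 1]`: the proxy `(1/2)²` is scaled by `v e ^ 2`.
  have hsub : ∀ e, HasSubgaussianMGF (fun ω => v e * (Y e ω - θ e))
      (NNReal.mk (v e ^ 2) (sq_nonneg _) * (‖(1 : ℝ) - 0‖₊ / 2) ^ 2) μ := by
    intro e
    have := hasSubgaussianMGF_of_mem_Icc (μ := μ) (X := Y e) (a := 0) (b := 1)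
      (hm e).aemeasurable (Filter.Eventually.of_forall fun ω => by
        rcases hY e ω with h | h <;> simp [h])
    rw [hmean] at this
    exact this.const_mul (v e)
  have hsum := HasSubgaussianMGF.sum_of_iIndepFun (s := Finset.univ)
    (hind.comp (fun e y => v e * (y - θ e)) fun e => by fun_prop) fun e _ => hsub e
  have hint := hsum.integrable_exp_mul 1
  have hle := hsum.mgf_le 1
  have hinner : ∀ ω, inner ℝ (WithLp.toLp 2 (fun e => Y e ω - θ e) : EuclideanSpace ℝ ι) v =
      ∑ e, v e * (Y e ω - θ e) := by
    intro ω
    simp [PiLp.inner_apply]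
  simp only [mgf, Function.comp_apply, one_mul] at hint hle
  simp only [hinner]
  rw [← ofReal_integral_eq_lintegral_ofReal hint
    (Filter.Eventually.of_forall fun _ => (Real.exp_pos _).le)]
  refine ENNReal.ofReal_le_ofReal (hle.trans_eq ?_)
  rw [EuclideanSpace.real_norm_sq_eq]
  congr 1
  push_cast
  simp only [Finset.mul_sum, Finset.sum_mul, Finset.sum_div]
  refine Finset.sum_congr rfl fun e _ => ?_
  simp
  ring

end Concentration

/-! ### Summability of the model weights -/

section Weights

/-- Uses `K.choose j ≤ x ^ j / j!`, `√2 ≤ 3/2` and `j ^ j / j! ≤ e ^ j ≤ 3 ^ j`. The factor `25` in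
the logarithm brings the ratio down to `(3/2) * 3 / 25 = 9/50`, so the sum over all `J` is
geometric. -/
theorem choose_mul_exp_neg_le {K j : ℕ} {x : ℝ} (hx : 0 < x) (hK : (K : ℝ) ≤ x) :
    (K.choose j : ℝ) * (√2 ^ (j + 1) * Real.exp (-(j * Real.log (25 * x / j)))) ≤
      3 / 2 * (9 / 50) ^ j := by
  have hexp : Real.exp (-(j * Real.log (25 * x / j))) = (j / (25 * x)) ^ j := by
    rcases Nat.eq_zero_or_pos j with rfl | hj
    · simp
    · have : (0 : ℝ) < j := by exact_mod_cast hj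
      rw [← mul_neg, ← Real.log_inv, inv_div, mul_comm, Real.exp_mul,
        Real.exp_log (by positivity), Real.rpow_natCast]
  have hfac : (j : ℝ) ^ j / j.factorial ≤ 3 ^ j := by
    calc _ ≤ Real.exp j := Real.pow_div_factorial_le_exp _ (by positivity) j
      _ = Real.exp 1 ^ j := by rw [← Real.exp_nat_mul, mul_one]
      _ ≤ 3 ^ j := by gcongr; linarith [Real.exp_one_lt_d9]
  have hs : √2 ≤ 3 / 2 := by
    rw [Real.sqrt_le_left (by norm_num)]; norm_num
  calc _ ≤ x ^ j / j.factorial * ((3 / 2) ^ (j + 1) * (j / (25 * x)) ^ j) := by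
        rw [hexp]
        gcongr
        exact (Nat.choose_le_pow_div j K).trans (by gcongr)
    _ = 3 / 2 * (3 / 50) ^ j * ((j : ℝ) ^ j / j.factorial) := by
        have h1 : ((3 : ℝ) / 50) ^ j = (3 / 2) ^ j / 25 ^ j := by
          rw [← div_pow]; norm_num
        rw [h1, pow_succ, div_pow (j : ℝ), mul_pow]
        field_simp
    _ ≤ 3 / 2 * (3 / 50) ^ j * 3 ^ j := by gcongr
    _ = _ := by rw [mul_assoc, ← mul_pow]; norm_num

theorem sum_finset_exp_neg_le {α : Type*} [Fintype α] {x : ℝ} (hx : 0 < x)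
    (hK : (Fintype.card α : ℝ) ≤ x) :
    ∑ J : Finset α, √2 ^ (J.card + 1) * Real.exp (-(J.card * Real.log (25 * x / J.card))) ≤
      2 := by
  rw [← Finset.powerset_univ, Finset.sum_powerset_apply_card
    (fun j : ℕ => √2 ^ (j + 1) * Real.exp (-(j * Real.log (25 * x / j))))]
  simp only [nsmul_eq_mul]
  refine (Finset.sum_le_sum fun j _ => choose_mul_exp_neg_le hx hK).trans ?_
  rw [← Finset.mul_sum]
  have := (summable_geometric_of_lt_one (show (0 : ℝ) ≤ 9 / 50 by norm_num)
    (by norm_num)).sum_le_tsum (Finset.range ((Finset.univ : Finset α).card + 1))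
    fun _ _ => by positivity
  rw [tsum_geometric_of_lt_one (by norm_num) (by norm_num)] at this
  norm_num at this ⊢
  linarith

theorem card_coefficients_le (m L : ℕ) :
    (Fintype.card (Fin L × ClassPair m) : ℝ) ≤ (m : ℝ) ^ 2 * L := by
  have h : Fintype.card (ClassPair m) ≤ m * m := by
    simpa using Fintype.card_subtype_le fun p : Fin m × Fin m => p.1 ≤ p.2
  have : Fintype.card (Fin L × ClassPair m) ≤ m ^ 2 * L := by
    rw [Fintype.card_prod, Fintype.card_fin]
    nlinarith
  exact_mod_cast this

theorem card_mul_log_nonneg {m L : ℕ} (J : Finset (Fin L × ClassPair m)) :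
    0 ≤ (J.card : ℝ) * Real.log (25 * (m : ℝ) ^ 2 * L / J.card) := by
  rcases Nat.eq_zero_or_pos J.card with h | h
  · simp [h]
  · have hJ : (0 : ℝ) < J.card := by exact_mod_cast h
    refine mul_nonneg hJ.le (Real.log_nonneg ?_)
    rw [le_div_iff₀ hJ]
    have h1 : (J.card : ℝ) ≤ Fintype.card (Fin L × ClassPair m) := by
      exact_mod_cast J.card_le_univ
    linarith [h1.trans (card_coefficients_le m L)]

/-- The exponential weight of the model `(m, J, C)`, with `s = |J|`, in the union bound. -/
noncomputable def weight {n L : ℕ} (𝒞 : (m : ℕ) → Finset (Clustering m n L)) (s m : ℕ) : ℝ :=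
  2 * Real.log ((𝒞 m).card : ℝ) + s * Real.log (25 * (m : ℝ) ^ 2 * L / s)

variable {n L : ℕ} {𝒞 : (m : ℕ) → Finset (Clustering m n L)}

theorem weight_le_pen {m : ℕ} (J : Finset (Fin L × ClassPair m)) :
    8 * weight 𝒞 J.card m ≤ 2 * pen 𝒞 J.card m := by
  have h1 := card_mul_log_nonneg J
  have h2 := Real.log_natCast_nonneg (𝒞 m).card
  unfold weight pen
  linarith

/-- The weight contributes `|𝒞 m|⁻²`: one factor pays for the sum over clusterings, and the other is
at most `m⁻²` by the assumption on `log |𝒞 m|`, which makes the sum over `m` converge. -/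
theorem sum_models_exp_neg_weight_le (hL : 1 ≤ L)
    (h𝒞 : ∀ m : ℕ, 1 ≤ m → m ≤ n →
      (𝒞 m).Nonempty ∧ 2 * Real.log (m : ℝ) ≤ Real.log ((𝒞 m).card : ℝ)) :
    ∑ m ∈ Finset.Icc 1 n, ∑ _z ∈ 𝒞 m, ∑ J : Finset (Fin L × ClassPair m),
      √2 ^ (J.card + 1) * Real.exp (-weight 𝒞 J.card m) ≤ 9 := by
  have hm : ∀ m ∈ Finset.Icc 1 n, ∑ _z ∈ 𝒞 m, ∑ J : Finset (Fin L × ClassPair m),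
      √2 ^ (J.card + 1) * Real.exp (-weight 𝒞 J.card m) ≤ 2 * ((m : ℝ) ^ 2)⁻¹ := by
    intro m hm
    rw [Finset.mem_Icc] at hm
    obtain ⟨hne, hlog⟩ := h𝒞 m hm.1 hm.2
    have hc : (0 : ℝ) < (𝒞 m).card := by exact_mod_cast hne.card_pos
    have hm0 : (0 : ℝ) < m := by exact_mod_cast hm.1
    have hL0 : (0 : ℝ) < L := by exact_mod_cast hL
    have hsq : (m : ℝ) ^ 2 ≤ (𝒞 m).card := by
      rw [← Real.log_le_log_iff (by positivity) hc, Real.log_pow]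
      exact_mod_cast hlog
    have hsplit : ∀ J : Finset (Fin L × ClassPair m),
        √2 ^ (J.card + 1) * Real.exp (-weight 𝒞 J.card m) =
          (((𝒞 m).card : ℝ) ^ 2)⁻¹ * (√2 ^ (J.card + 1) *
            Real.exp (-(J.card * Real.log (25 * ((m : ℝ) ^ 2 * L) / J.card)))) := by
      intro J
      have h2 : Real.exp (-(2 * Real.log ((𝒞 m).card : ℝ))) = (((𝒞 m).card : ℝ) ^ 2)⁻¹ := by
        rw [Real.exp_neg, mul_comm, Real.exp_mul, Real.exp_log hc]
        norm_cast
      rw [weight, neg_add, Real.exp_add, h2, ← mul_assoc 25]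
      ring
    have hsum := sum_finset_exp_neg_le (x := (m : ℝ) ^ 2 * L) (by positivity)
      (card_coefficients_le m L)
    simp only [hsplit, Finset.sum_const, nsmul_eq_mul]
    rw [← Finset.mul_sum]
    calc _ ≤ ((𝒞 m).card : ℝ) * ((((𝒞 m).card : ℝ) ^ 2)⁻¹ * 2) := by gcongr
      _ = 2 * ((𝒞 m).card : ℝ)⁻¹ := by field_simp
      _ ≤ _ := by gcongr
  refine (Finset.sum_le_sum hm).trans ?_
  rw [← Finset.mul_sum]
  -- The inverse squares sum to at most `2`, so the total is at most `4`, well below `9`.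
  have hI : Finset.Icc 1 n = Finset.Ioo 0 (n + 1) := by
    ext i; simp only [Finset.mem_Icc, Finset.mem_Ioo]; omega
  have := sum_Ioo_inv_sq_le (α := ℝ) 0 (n + 1)
  rw [hI]
  norm_num at this ⊢
  linarith

end Weights

/-! ### Tensor norm and attainment of the oracle minimum -/

section Oracle

variable {n L : ℕ}

theorem sqNorm_eq_sq_norm {ι : Type*} [Fintype ι] (x : ι → ℝ) :
    sqNorm x = ‖(WithLp.toLp 2 x : EuclideanSpace ℝ ι)‖ ^ 2 := by
  simp [sqNorm, EuclideanSpace.real_norm_sq_eq]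

/-- Each pair `i < j` occurs twice in the tensor and the diagonal vanishes. This factor `2` turns
the constants `3`, `2`, `8` of the vector bound into `6`, `4`, `16`. -/
theorem tensorSqNorm_pack_sub (θ : Fin L × NodePair n → ℝ) (Λ : Fin n → Fin n → Fin L → ℝ)
    (hsymm : ∀ i j l, Λ i j l = Λ j i l) (hdiag : ∀ i l, Λ i i l = 0) :
    tensorSqNorm (pack θ - Λ) = 2 * sqNorm (θ - vectorize Λ) := by
  have hslice : ∀ l, ∑ i, ∑ j, (pack θ - Λ) i j l ^ 2 =
      2 * ∑ q : NodePair n, (θ (l, q) - Λ q.1.1 q.1.2 l) ^ 2 := by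
    intro l
    set F : Fin n × Fin n → ℝ := fun q => (pack θ - Λ) q.1 q.2 l ^ 2 with hF
    have hFsymm : ∀ q, F q.swap = F q := by
      rintro ⟨i, j⟩
      simp only [hF, Pi.sub_apply, Prod.swap, hsymm j i l, pack]
      rcases lt_trichotomy i j with h | h | h
      · simp [h, h.not_gt]
      · simp [h]
      · simp [h, h.not_gt]
    have hFdiag : ∀ q : Fin n × Fin n, q.1 = q.2 → F q = 0 := by
      rintro ⟨i, j⟩ h
      obtain rfl : i = j := h
      simp [hF, pack, hdiag]
    have hlt : ∑ q : NodePair n, (θ (l, q) - Λ q.1.1 q.1.2 l) ^ 2 =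
        ∑ q with q.1 < q.2, F q := by
      rw [← Finset.sum_subtype_eq_sum_filter, Finset.subtype_univ]
      refine Finset.sum_congr rfl fun q _ => ?_
      simp [hF, pack, q.2]
    have hgt : ∑ q with q.2 < q.1, F q = ∑ q with q.1 < q.2, F q := by
      refine Finset.sum_nbij' Prod.swap Prod.swap ?_ ?_ ?_ ?_ ?_ <;>
        simp [hFsymm]
    have hnot : ∑ q with ¬ q.1 < q.2, F q = ∑ q with q.2 < q.1, F q := by
      symm
      refine Finset.sum_subset ?_ ?_
      · intro q
        simp only [Finset.mem_filter, Finset.mem_univ, true_and]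
        exact fun h => h.not_gt
      · intro q h1 h2
        simp only [Finset.mem_filter, Finset.mem_univ, true_and, not_lt] at h1 h2
        exact hFdiag q (le_antisymm h2 h1)
    rw [← Fintype.sum_prod_type' (f := fun i j => (pack θ - Λ) i j l ^ 2), hlt]
    rw [← Finset.sum_filter_add_sum_filter_not Finset.univ (fun q : Fin n × Fin n => q.1 < q.2),
      hnot, hgt]
    ring
  simp only [tensorSqNorm, hslice, sqNorm, ← Finset.mul_sum]
  rw [Fintype.sum_prod_type]
  rfl

theorem exists_sqNorm_fit_truncate_minimal {m : ℕ} (H : Matrix (Fin L) (Fin L) ℝ)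
    (z : Clustering m n L) (J : Finset (Fin L × ClassPair m)) (θ : Fin L × NodePair n → ℝ) :
    ∃ d₀, ∀ d, sqNorm (fit H z (truncate J d₀) - θ) ≤ sqNorm (fit H z (truncate J d) - θ) := by
  let T : (Fin L × ClassPair m → ℝ) →ₗ[ℝ] Fin L × ClassPair m → ℝ :=
    { toFun := truncate J
      map_add' := fun x y => by funext j; by_cases h : j ∈ J <;> simp [truncate, h]
      map_smul' := fun c x => by funext j; by_cases h : j ∈ J <;> simp [truncate, h] }
  let f : (Fin L × ClassPair m → ℝ) →ₗ[ℝ] EuclideanSpace ℝ (Fin L × NodePair n) :=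
    (WithLp.linearEquiv 2 ℝ _).symm.toLinearMap ∘ₗ
      (clusterMatrix z * (transformMatrix H m).transpose).mulVecLin ∘ₗ T
  have hf : ∀ d, sqNorm (fit H z (truncate J d) - θ) = ‖WithLp.toLp 2 θ - f d‖ ^ 2 := by
    intro d
    rw [sqNorm_eq_sq_norm, norm_sub_rev, WithLp.toLp_sub]
    rfl
  obtain ⟨d₀, hd₀⟩ : (LinearMap.range f).starProjection (WithLp.toLp 2 θ) ∈ LinearMap.range f :=
    Submodule.starProjection_apply_mem _ _
  refine ⟨d₀, fun d => ?_⟩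
  rw [hf, hf, hd₀, Submodule.starProjection_minimal]
  have hb : BddBelow (Set.range fun x : LinearMap.range f => ‖WithLp.toLp 2 θ - (x : _)‖) :=
    ⟨0, by rintro _ ⟨x, rfl⟩; exact norm_nonneg _⟩
  have := ciInf_le hb ⟨f d, d, rfl⟩
  have h0 : 0 ≤ ⨅ x : LinearMap.range f, ‖WithLp.toLp 2 θ - (x : _)‖ :=
    Real.iInf_nonneg fun _ => norm_nonneg _
  gcongr

/-- For fixed `(m, J, C)` the best `d` comes from an orthogonal projection; only finitely many
triples remain. -/
theorem exists_oracle_minimizer (hn : 1 ≤ n) (H : Matrix (Fin L) (Fin L) ℝ)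
    (𝒞 : (m : ℕ) → Finset (Clustering m n L)) (h𝒞 : (𝒞 1).Nonempty)
    (θ : Fin L × NodePair n → ℝ) :
    ∃ p : Params n L, p.Admissible 𝒞 ∧ ∀ q : Params n L, q.Admissible 𝒞 →
      oracleValue H 𝒞 θ p ≤ oracleValue H 𝒞 θ q := by
  choose d₀ hd₀ using fun (m : ℕ) (z : Clustering m n L) (J : Finset (Fin L × ClassPair m)) =>
    exists_sqNorm_fit_truncate_minimal H z J θ
  let toParams : (Σ m : ℕ, Clustering m n L × Finset (Fin L × ClassPair m)) → Params n L :=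
    fun x => ⟨x.1, x.2.2, d₀ x.1 x.2.1 x.2.2, x.2.1⟩
  obtain ⟨z₁, hz₁⟩ := h𝒞
  obtain ⟨x, hx, hmin⟩ := Finset.exists_min_image
    ((Finset.Icc 1 n).sigma fun m => 𝒞 m ×ˢ (Finset.univ : Finset (Finset (Fin L × ClassPair m))))
    (fun x => oracleValue H 𝒞 θ (toParams x))
    ⟨⟨1, z₁, ∅⟩, by simp [hn, hz₁]⟩
  simp only [Finset.mem_sigma, Finset.mem_Icc, Finset.mem_product, Finset.mem_univ,
    and_true] at hx hmin
  refine ⟨toParams x, ⟨hx.1.1, hx.1.2, hx.2⟩, fun q hq => ?_⟩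
  refine (hmin ⟨q.m, q.z, q.J⟩ ⟨⟨hq.1, hq.2.1⟩, hq.2.2⟩).trans ?_
  simp only [oracleValue, toParams]
  gcongr ?_ + _
  gcongr
  exact hd₀ _ _ _ _

end Oracle

/-- Deterministic error bound for a penalized least squares solution `θ'` compared with `η`. -/
theorem sq_norm_sub_le_of_penalized {E : Type*} [NormedAddCommGroup E] [InnerProductSpace ℝ E]
    (U : Submodule ℝ E) [U.HasOrthogonalProjection] {a θ θ' η : E} {P P' : ℝ}
    (hU : θ' - η ∈ U) (h : ‖a - θ'‖ ^ 2 + P' ≤ ‖a - η‖ ^ 2 + P) :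
    ‖θ' - θ‖ ^ 2 ≤
      3 * ‖η - θ‖ ^ 2 + 8 * ‖U.starProjection (a - θ)‖ ^ 2 + 2 * P - 2 * P' := by
  have h1 : ‖a - θ'‖ ^ 2 = ‖a - θ‖ ^ 2 - 2 * inner ℝ (a - θ) (θ' - θ) + ‖θ' - θ‖ ^ 2 := by
    rw [← norm_sub_sq_real, sub_sub_sub_cancel_right]
  have h2 : ‖a - η‖ ^ 2 = ‖a - θ‖ ^ 2 - 2 * inner ℝ (a - θ) (η - θ) + ‖η - θ‖ ^ 2 := by
    rw [← norm_sub_sq_real, sub_sub_sub_cancel_right]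
  have h3 : inner ℝ (a - θ) (θ' - θ) - inner ℝ (a - θ) (η - θ) =
      inner ℝ (U.starProjection (a - θ)) (θ' - η) := by
    rw [← inner_sub_right, sub_sub_sub_cancel_right, U.inner_starProjection_left_eq_right,
      Submodule.starProjection_eq_self_iff.2 hU]
  have h4 := real_inner_le_norm (U.starProjection (a - θ)) (θ' - η)
  have h5 : ‖θ' - η‖ ≤ ‖θ' - θ‖ + ‖η - θ‖ := by
    simpa using norm_sub_le (θ' - θ) (η - θ)
  have h6 := mul_le_mul_of_nonneg_left h5 (norm_nonneg (U.starProjection (a - θ)))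
  -- With `x = ‖Π (a - θ)‖`, use `2xA ≤ A²/2 + 2x²` for both `A = ‖θ' - θ‖` and `A = ‖η - θ‖`,
  -- absorb half of `‖θ' - θ‖²` on the left, and double.
  nlinarith [sq_nonneg (‖θ' - θ‖ - 2 * ‖U.starProjection (a - θ)‖),
    sq_nonneg (‖η - θ‖ - 2 * ‖U.starProjection (a - θ)‖)]

/-! ### Model spaces and the union over models -/

section ModelSpace

variable {n L : ℕ}

/-- The space of the vectors `C Wᵀ d` with `d` supported in `J`, enlarged by `η`. -/
noncomputable def modelSpace {m : ℕ} (H : Matrix (Fin L) (Fin L) ℝ) (z : Clustering m n L)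
    (J : Finset (Fin L × ClassPair m)) (η : Fin L × NodePair n → ℝ) :
    Submodule ℝ (EuclideanSpace ℝ (Fin L × NodePair n)) :=
  Submodule.span ℝ (insert (WithLp.toLp 2 η)
    ((fun j => WithLp.toLp 2 (fit H z (Pi.single j 1))) '' (J : Set _)))

theorem finrank_modelSpace_le {m : ℕ} (H : Matrix (Fin L) (Fin L) ℝ) (z : Clustering m n L)
    (J : Finset (Fin L × ClassPair m)) (η : Fin L × NodePair n → ℝ) :
    Module.finrank ℝ (modelSpace H z J η) ≤ J.card + 1 := by
  classical
  have h := finrank_span_finset_le_card (R := ℝ) (insert (WithLp.toLp 2 η)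
    (J.image fun j => (WithLp.toLp 2 (fit H z (Pi.single j 1)) :
      EuclideanSpace ℝ (Fin L × NodePair n))))
  rw [Finset.coe_insert, Finset.coe_image] at h
  refine (h.trans (Finset.card_insert_le _ _)).trans ?_
  gcongr
  exact Finset.card_image_le

theorem fit_sub_mem_modelSpace {m : ℕ} (H : Matrix (Fin L) (Fin L) ℝ) (z : Clustering m n L)
    (J : Finset (Fin L × ClassPair m)) (η : Fin L × NodePair n → ℝ)
    (d : Fin L × ClassPair m → ℝ) (hd : ∀ j, j ∉ J → d j = 0) :
    WithLp.toLp 2 (fit H z d) - WithLp.toLp 2 η ∈ modelSpace H z J η := by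
  have hsum : d = ∑ j ∈ J, d j • Pi.single j (1 : ℝ) := by
    funext i
    by_cases hi : i ∈ J <;> simp [Finset.sum_apply, Pi.single_apply, hi, hd]
  have hfit : WithLp.toLp 2 (fit H z d) =
      ∑ j ∈ J, d j • (WithLp.toLp 2 (fit H z (Pi.single j 1)) :
        EuclideanSpace ℝ (Fin L × NodePair n)) := by
    conv_lhs => rw [hsum]
    simp only [fit, Matrix.mulVec_sum, Matrix.mulVec_smul, WithLp.toLp_sum, WithLp.toLp_smul]
  rw [hfit]
  refine sub_mem (Submodule.sum_mem _ fun j hj => Submodule.smul_mem _ _ ?_) ?_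
  · exact Submodule.subset_span (Or.inr ⟨j, hj, rfl⟩)
  · exact Submodule.subset_span (Or.inl rfl)

/-- The sum over all models of the weighted exponentials of the squared projected noise. -/
noncomputable def noiseSum (H : Matrix (Fin L) (Fin L) ℝ)
    (𝒞 : (m : ℕ) → Finset (Clustering m n L)) (η : Fin L × NodePair n → ℝ)
    (ξ : EuclideanSpace ℝ (Fin L × NodePair n)) : ℝ :=
  ∑ m ∈ Finset.Icc 1 n, ∑ z ∈ 𝒞 m, ∑ J : Finset (Fin L × ClassPair m),
    Real.exp (‖(modelSpace H z J η).starProjection ξ‖ ^ 2) * Real.exp (-weight 𝒞 J.card m)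

theorem noiseSum_nonneg (H : Matrix (Fin L) (Fin L) ℝ)
    (𝒞 : (m : ℕ) → Finset (Clustering m n L)) (η : Fin L × NodePair n → ℝ)
    (ξ : EuclideanSpace ℝ (Fin L × NodePair n)) : 0 ≤ noiseSum H 𝒞 η ξ := by
  unfold noiseSum
  exact Finset.sum_nonneg fun m _ => Finset.sum_nonneg fun z _ => Finset.sum_nonneg fun J _ => by
    positivity

/-- All summands are nonnegative, so one of them is at most the sum; `p` may therefore depend on the
data. -/
theorem exp_le_noiseSum (H : Matrix (Fin L) (Fin L) ℝ)
    (𝒞 : (m : ℕ) → Finset (Clustering m n L)) (η : Fin L × NodePair n → ℝ)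
    (ξ : EuclideanSpace ℝ (Fin L × NodePair n)) (p : Params n L) (hp : p.Admissible 𝒞) :
    Real.exp (‖(modelSpace H p.z p.J η).starProjection ξ‖ ^ 2 - weight 𝒞 p.J.card p.m) ≤
      noiseSum H 𝒞 η ξ := by
  rw [sub_eq_add_neg, Real.exp_add]
  calc _ ≤ ∑ J : Finset (Fin L × ClassPair p.m),
        Real.exp (‖(modelSpace H p.z J η).starProjection ξ‖ ^ 2) *
          Real.exp (-weight 𝒞 J.card p.m) :=
        Finset.single_le_sum
          (f := fun J => Real.exp (‖(modelSpace H p.z J η).starProjection ξ‖ ^ 2) *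
            Real.exp (-weight 𝒞 J.card p.m))
          (fun _ _ => by positivity) (Finset.mem_univ p.J)
    _ ≤ ∑ z ∈ 𝒞 p.m, ∑ J : Finset (Fin L × ClassPair p.m),
        Real.exp (‖(modelSpace H z J η).starProjection ξ‖ ^ 2) *
          Real.exp (-weight 𝒞 J.card p.m) :=
        Finset.single_le_sum
          (f := fun z => ∑ J : Finset (Fin L × ClassPair p.m),
            Real.exp (‖(modelSpace H z J η).starProjection ξ‖ ^ 2) *
              Real.exp (-weight 𝒞 J.card p.m))
          (fun _ _ => by positivity) hp.2.2
    _ ≤ _ :=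
        Finset.single_le_sum
          (f := fun m => ∑ z ∈ 𝒞 m, ∑ J : Finset (Fin L × ClassPair m),
            Real.exp (‖(modelSpace H z J η).starProjection ξ‖ ^ 2) *
              Real.exp (-weight 𝒞 J.card m))
          (fun _ _ => by positivity) (Finset.mem_Icc.2 ⟨hp.1, hp.2.1⟩)

theorem noiseSum_moment {Ω : Type*} [MeasurableSpace Ω] (μ : Measure Ω) [SFinite μ]
    (X : Ω → EuclideanSpace ℝ (Fin L × NodePair n)) (hX : Measurable X)
    (hsub : ∀ v, ∫⁻ ω, ENNReal.ofReal (Real.exp (inner ℝ (X ω) v)) ∂μ ≤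
      ENNReal.ofReal (Real.exp (1 / 8 * ‖v‖ ^ 2)))
    (hL : 1 ≤ L) (H : Matrix (Fin L) (Fin L) ℝ) (𝒞 : (m : ℕ) → Finset (Clustering m n L))
    (h𝒞 : ∀ m : ℕ, 1 ≤ m → m ≤ n →
      (𝒞 m).Nonempty ∧ 2 * Real.log (m : ℝ) ≤ Real.log ((𝒞 m).card : ℝ))
    (η : Fin L × NodePair n → ℝ) :
    Integrable (fun ω => noiseSum H 𝒞 η (X ω)) μ ∧ ∫ ω, noiseSum H 𝒞 η (X ω) ∂μ ≤ 9 := by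
  have hterm : ∀ (m : ℕ) (z : Clustering m n L) (J : Finset (Fin L × ClassPair m)),
      Integrable (fun ω => Real.exp (‖(modelSpace H z J η).starProjection (X ω)‖ ^ 2) *
        Real.exp (-weight 𝒞 J.card m)) μ := fun m z J =>
    (exp_sq_norm_starProjection_moment μ X hX hsub (modelSpace H z J η)).1.mul_const _
  unfold noiseSum
  refine ⟨integrable_finsetSum _ fun m _ => integrable_finsetSum _ fun z _ =>
    integrable_finsetSum _ fun J _ => hterm m z J, ?_⟩
  rw [integral_finsetSum _ fun m _ => integrable_finsetSum _ fun z _ =>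
    integrable_finsetSum _ fun J _ => hterm m z J]
  refine le_trans ?_ (sum_models_exp_neg_weight_le hL h𝒞)
  refine Finset.sum_le_sum fun m _ => ?_
  rw [integral_finsetSum _ fun z _ => integrable_finsetSum _ fun J _ => hterm m z J]
  refine Finset.sum_le_sum fun z _ => ?_
  rw [integral_finsetSum _ fun J _ => hterm m z J]
  refine Finset.sum_le_sum fun J _ => ?_
  rw [integral_mul_const]
  gcongr
  refine (exp_sq_norm_starProjection_moment μ X hX hsub (modelSpace H z J η)).2.trans ?_
  exact pow_le_pow_right₀ (Real.one_le_sqrt.2 one_le_two) (finrank_modelSpace_le H z J η)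

/-- The oracle inequality on the level of a single observation `a`. -/
theorem sqNorm_fit_sub_le_of_isSolution (H : Matrix (Fin L) (Fin L) ℝ)
    (𝒞 : (m : ℕ) → Finset (Clustering m n L)) (a θ : Fin L × NodePair n → ℝ)
    (p q : Params n L) (hp : IsSolution H 𝒞 a p) (hq : q.Admissible 𝒞) :
    sqNorm (fit H p.z p.d - θ) ≤
      3 * sqNorm (fit H q.z (truncate q.J q.d) - θ) + 2 * pen 𝒞 q.J.card q.m +
        8 * Real.log (noiseSum H 𝒞 (fit H q.z (truncate q.J q.d)) (WithLp.toLp 2 (a - θ))) := by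
  set η := fit H q.z (truncate q.J q.d)
  -- Truncating `q.d` makes the oracle feasible for the support constraint.
  have hobj := hp.2 ⟨q.m, q.J, truncate q.J q.d, q.z⟩ hq fun j hj => by
    simp only at hj
    simp [truncate, hj]
  simp only [objective, sqNorm_eq_sq_norm, WithLp.toLp_sub] at hobj ⊢
  have hdet := sq_norm_sub_le_of_penalized (modelSpace H p.z p.J η) (θ := WithLp.toLp 2 θ)
    (fit_sub_mem_modelSpace H p.z p.J η p.d hp.1.2) hobj
  have hlog := Real.log_le_log (Real.exp_pos _)
    (exp_le_noiseSum H 𝒞 η (WithLp.toLp 2 a - WithLp.toLp 2 θ) p hp.1.1)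
  rw [Real.log_exp] at hlog
  linarith [weight_le_pen (𝒞 := 𝒞) p.J]

end ModelSpace

end DSBM

/-! ### The oracle inequality in probability and in expectation -/

theorem theorem1 (n L : ℕ) (hn : 1 ≤ n) (hL : 1 ≤ L)
    (H : Matrix (Fin L) (Fin L) ℝ) (hH : H ∈ Matrix.orthogonalGroup (Fin L) ℝ)
    (𝒞 : (m : ℕ) → Finset (DSBM.Clustering m n L))
    (h𝒞 : ∀ m : ℕ, 1 ≤ m → m ≤ n →
      (𝒞 m).Nonempty ∧ 2 * Real.log (m : ℝ) ≤ Real.log ((𝒞 m).card : ℝ))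
    {Ω : Type*} [MeasurableSpace Ω] (μ : MeasureTheory.Measure Ω)
    [MeasureTheory.IsProbabilityMeasure μ]
    (Λ : Fin n → Fin n → Fin L → ℝ) (hΛ : DSBM.IsBlockTensor Λ)
    (B : Ω → Fin n → Fin n → Fin L → ℝ) (hB : DSBM.IsAdjacencyTensor μ Λ B)
    (est : Ω → DSBM.Params n L)
    (hest : ∀ ω, DSBM.IsSolution H 𝒞 (DSBM.vectorize (B ω)) (est ω))
    (hmeas : ∀ i j l, Measurable fun ω => DSBM.estimate H (est ω) i j l) :
    ∃ r : ℝ,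
      IsLeast {x : ℝ | ∃ p : DSBM.Params n L,
        p.Admissible 𝒞 ∧ x = DSBM.oracleValue H 𝒞 (DSBM.vectorize Λ) p} r ∧
      (∀ t : ℝ, 0 < t →
        1 - 9 * Real.exp (-t) ≤
          μ.real {ω | DSBM.normError (DSBM.estimate H (est ω)) Λ ≤
            r + 38 * t / ((n : ℝ) ^ 2 * (L : ℝ))}) ∧
      MeasureTheory.Integrable (fun ω => DSBM.normError (DSBM.estimate H (est ω)) Λ) μ ∧
      ∫ ω, DSBM.normError (DSBM.estimate H (est ω)) Λ ∂μ ≤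
        r + 342 / ((n : ℝ) ^ 2 * (L : ℝ)) := by
  obtain ⟨q, hq, hqmin⟩ := DSBM.exists_oracle_minimizer hn H 𝒞 (h𝒞 1 le_rfl hn).1
    (DSBM.vectorize Λ)
  have hsymm : ∀ i j l, Λ i j l = Λ j i l := fun i j l => by
    rw [← hB.prob i j l, ← hB.prob j i l]
    simp only [hB.symm _ i j l]
  have hdiag : ∀ i l, Λ i i l = 0 := by
    obtain ⟨_, _, _, _, _, _, h⟩ := hΛ
    exact h
  let X : Ω → EuclideanSpace ℝ (Fin L × DSBM.NodePair n) := fun ω =>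
    WithLp.toLp 2 (DSBM.vectorize (B ω) - DSBM.vectorize Λ)
  have hvec : ∀ e, Measurable fun ω => DSBM.vectorize (B ω) e := fun e => hB.measurable _ _ _
  have hX : Measurable X := by
    refine (WithLp.measurable_toLp 2 _).comp (measurable_pi_lambda _ fun e => ?_)
    exact (hvec e).sub_const _
  have hsub := DSBM.lintegral_exp_inner_centered_le μ (fun e ω => DSBM.vectorize (B ω) e)
    (DSBM.vectorize Λ) hvec (fun e ω => hB.binary _ _ _ _) (fun e => hB.prob _ _ _) hB.indep
  set S : Ω → ℝ := fun ω =>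
    DSBM.noiseSum H 𝒞 (DSBM.fit H q.z (DSBM.truncate q.J q.d)) (X ω)
  obtain ⟨hSint, hSle⟩ := DSBM.noiseSum_moment μ X hX hsub hL H 𝒞 h𝒞
    (DSBM.fit H q.z (DSBM.truncate q.J q.d))
  have hS0 : ∀ ω, 0 ≤ S ω := fun ω => DSBM.noiseSum_nonneg _ _ _ _
  have hn0 : (0 : ℝ) < n := by exact_mod_cast hn
  have hL0 : (0 : ℝ) < L := by exact_mod_cast hL
  set D : ℝ := (n : ℝ) ^ 2 * (L : ℝ) with hD
  have hD0 : 0 < D := by positivity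
  set r := DSBM.oracleValue H 𝒞 (DSBM.vectorize Λ) q with hr
  have hpath : ∀ ω, DSBM.normError (DSBM.estimate H (est ω)) Λ ≤
      r + 16 * Real.log (S ω) / D := by
    intro ω
    have h := DSBM.sqNorm_fit_sub_le_of_isSolution H 𝒞 _ (DSBM.vectorize Λ) (est ω) q (hest ω) hq
    rw [DSBM.normError, DSBM.estimate, DSBM.tensorSqNorm_pack_sub _ _ hsymm hdiag, hr,
      DSBM.oracleValue, ← hD, ← add_div, ← add_div]
    gcongr
    linarith
  have hmeasErr : Measurable fun ω => DSBM.normError (DSBM.estimate H (est ω)) Λ := by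
    unfold DSBM.normError DSBM.tensorSqNorm
    simp only [Pi.sub_apply]
    fun_prop
  -- The coefficient `16` is relaxed to `38`, so that `E S ≤ 9` yields `38 * 9 = 342`.
  have hbound : ∀ ω, DSBM.normError (DSBM.estimate H (est ω)) Λ ≤ r + 38 / D * S ω := by
    intro ω
    refine (hpath ω).trans ?_
    have := Real.log_le_self (hS0 ω)
    have hnum : 16 * Real.log (S ω) ≤ 38 * S ω := by linarith [hS0 ω]
    rw [div_mul_eq_mul_div]
    exact add_le_add_right (div_le_div_of_nonneg_right hnum hD0.le) r
  have herr0 : ∀ ω, 0 ≤ DSBM.normError (DSBM.estimate H (est ω)) Λ := fun ω => by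
    unfold DSBM.normError DSBM.tensorSqNorm
    positivity
  have hdom : Integrable (fun ω => r + 38 / D * S ω) μ :=
    (integrable_const r).add (hSint.const_mul _)
  have hint : Integrable (fun ω => DSBM.normError (DSBM.estimate H (est ω)) Λ) μ :=
    hdom.mono' hmeasErr.aestronglyMeasurable (Filter.Eventually.of_forall fun ω => by
      rw [Real.norm_of_nonneg (herr0 ω)]
      exact hbound ω)
  refine ⟨r, ⟨⟨q, hq, rfl⟩, ?_⟩, fun t ht => ?_, hint, ?_⟩
  · rintro _ ⟨p, hp, rfl⟩
    exact hqmin p hp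
  · have hmarkov := mul_meas_ge_le_integral_of_nonneg
      (Filter.Eventually.of_forall hS0) hSint (Real.exp t)
    have htail : μ.real {ω | Real.exp t ≤ S ω} ≤ 9 * Real.exp (-t) := by
      rw [Real.exp_neg, ← div_eq_mul_inv, le_div_iff₀ (Real.exp_pos t), mul_comm]
      exact hmarkov.trans hSle
    have hset : MeasurableSet {ω | DSBM.normError (DSBM.estimate H (est ω)) Λ ≤
        r + 38 * t / D} := measurableSet_le hmeasErr measurable_const
    have hcompl := probReal_compl_eq_one_sub (μ := μ) hset
    have hmono : μ.real {ω | DSBM.normError (DSBM.estimate H (est ω)) Λ ≤ r + 38 * t / D}ᶜ ≤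
        μ.real {ω | Real.exp t ≤ S ω} := by
      refine measureReal_mono fun ω hω => ?_
      by_contra hlt
      replace hlt : S ω < Real.exp t := not_le.1 hlt
      have hnum : 16 * Real.log (S ω) ≤ 38 * t := by
        -- Only `S ≥ 0` is at hand; at `S = 0` the convention `Real.log 0 = 0` and `t > 0` suffice.
        rcases (hS0 ω).eq_or_lt with h0 | hpos
        · rw [← h0, Real.log_zero]
          linarith
        · linarith [(Real.log_lt_iff_lt_exp hpos).2 hlt]
      exact hω ((hpath ω).trans
        (add_le_add_right (div_le_div_of_nonneg_right hnum hD0.le) r))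
    linarith
  · refine (integral_mono hint hdom hbound).trans ?_
    rw [integral_add (integrable_const r) (hSint.const_mul _), integral_const_mul]
    simp only [integral_const, probReal_univ, one_smul]
    calc r + 38 / D * ∫ ω, S ω ∂μ ≤ r + 38 / D * 9 := by gcongr
      _ = r + 342 / D := by ring
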